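/- Let $\triangle$ be the open unit disc in $\mathbb{C}$. The Zygmund space $\mathcal{Z}$ is the space of all analytic functions $f:\triangle\to\mathbb{C}$ that extend continuously to the closed disc and satisfy $\sup_{|z|<1}(1-|z|^2)|f''(z)|<\infty$, with the norm $\|f\|_{\mathcal{Z}}=|f(0)|+|f'(0)|+\sup_{|z|<1}(1-|z|^2)|f''(z)|$. Let $$\mathcal{Z}_0^{(0,1)}=\Big\{f\in\mathcal{Z}:\ \lim_{|z|\to1^-}(1-|z|^2)|f''(z)|=0,\ f(0)=f'(0)=0\Big\},$$ with the same norm. A disc automorphism is a biholomorphic bijection of $\triangle$ onto itself. Theorem. Let $T:\mathcal{Z}_0^{(0,1)}\to\mathcal{Z}_0^{(0,1)}$ be a map. Then $T$ is a surjective (complex-)linear isometry if and only if there exist a disc automorphism $\sigma$ and a real number $\alpha$ such that, for every $f\in\mathcal{Z}_0^{(0,1)}$ and every $z\in\triangle$, $$Tf(z)=e^{i\alpha}\int_0^z\big[f'(\sigma(\xi))-f'(\sigma(0))\big]\,d\xi .$$ Moreover, for every disc automorphism $\sigma$, every real $\alpha$ and every $f\in\mathcal{Z}_0^{(0,1)}$,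 this formula holds for all $z\in\triangle$ if and only if $(Tf)''(z)=e^{i\alpha}\,\sigma'(z)\,f''(\sigma(z))$ for all $z\in\triangle$. -/

import Mathlib

open scoped Complex.UnitDisc Topology

noncomputable section

namespace Zygmund

/-- A function on the open unit disc, extended by `0` to the whole plane. The values off the disc
are never used; the extension only serves to speak about complex derivatives and integrals. -/
def toPlane (f : 𝔻 → ℂ) (z : ℂ) : ℂ :=
  if h : ‖z‖ < 1 then f (Complex.UnitDisc.mk z h) else 0

/-- `f` is analytic (holomorphic) on the open unit disc. -/
def IsHolo (f : 𝔻 → ℂ) : Prop :=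
  DifferentiableOn ℂ (toPlane f) (Metric.ball (0 : ℂ) 1)

/-- The complex derivative `f'` of a function on the open unit disc, again a function on the
disc; `D (D f)` is `f''`. -/
def D (f : 𝔻 → ℂ) (z : 𝔻) : ℂ :=
  deriv (toPlane f) (z : ℂ)

/-- The integral `∫_0^z g(ξ) dξ` along the segment from `0` to `z`. -/
def integralFromZero (g : 𝔻 → ℂ) (z : 𝔻) : ℂ :=
  ∫ t in (0 : ℝ)..1, toPlane g ((t : ℂ) * (z : ℂ)) * (z : ℂ)

/-- A disc automorphism: a bijection of the open unit disc onto itself which is holomorphic and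
whose inverse is holomorphic. -/
def IsDiscAutomorphism (σ : 𝔻 ≃ 𝔻) : Prop :=
  IsHolo (fun z => (σ z : ℂ)) ∧ IsHolo (fun z => (σ.symm z : ℂ))

/-- The weighted second derivative `(1 - |z|^2) |f''(z)|`. -/
def weight (f : 𝔻 → ℂ) (z : 𝔻) : ℝ :=
  (1 - ‖(z : ℂ)‖ ^ 2) * ‖D (D f) z‖

/-- `f` extends continuously to the closed unit disc. -/
def ExtendsToBoundary (f : 𝔻 → ℂ) : Prop :=
  ∃ F : ℂ → ℂ, ContinuousOn F (Metric.closedBall (0 : ℂ) 1) ∧ ∀ z : 𝔻, F (z : ℂ) = f z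

theorem toPlane_coe (f : 𝔻 → ℂ) (z : 𝔻) : toPlane f (z : ℂ) = f z := by
  simp [toPlane, z.norm_lt_one]

theorem coe_mem_ball (z : 𝔻) : (z : ℂ) ∈ Metric.ball (0 : ℂ) 1 :=
  mem_ball_zero_iff.2 z.norm_lt_one

theorem toPlane_add (f g : 𝔻 → ℂ) : toPlane (f + g) = toPlane f + toPlane g := by
  funext z
  by_cases h : ‖z‖ < 1 <;> simp [toPlane, h]

theorem toPlane_smul (c : ℂ) (f : 𝔻 → ℂ) : toPlane (c • f) = c • toPlane f := by
  funext z
  by_cases h : ‖z‖ < 1 <;> simp [toPlane, h]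

theorem toPlane_zero : toPlane 0 = 0 := by
  funext z
  simp [toPlane]

theorem IsHolo.differentiableAt {f : 𝔻 → ℂ} (hf : IsHolo f) (z : 𝔻) :
    DifferentiableAt ℂ (toPlane f) (z : ℂ) :=
  DifferentiableOn.differentiableAt hf (Metric.isOpen_ball.mem_nhds (coe_mem_ball z))

theorem toPlane_D_eqOn (f : 𝔻 → ℂ) :
    Set.EqOn (toPlane (D f)) (deriv (toPlane f)) (Metric.ball (0 : ℂ) 1) := by
  intro z hz
  have h : ‖z‖ < 1 := mem_ball_zero_iff.1 hz
  simp [toPlane, h, D]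

theorem IsHolo.D {f : 𝔻 → ℂ} (hf : IsHolo f) : IsHolo (D f) :=
  (DifferentiableOn.deriv hf Metric.isOpen_ball).congr (toPlane_D_eqOn f)

theorem IsHolo.zero : IsHolo 0 := by
  unfold IsHolo
  rw [toPlane_zero]
  exact differentiableOn_const (0 : ℂ)

theorem IsHolo.add {f g : 𝔻 → ℂ} (hf : IsHolo f) (hg : IsHolo g) : IsHolo (f + g) := by
  unfold IsHolo
  rw [toPlane_add]
  exact DifferentiableOn.add hf hg

theorem IsHolo.smul {f : 𝔻 → ℂ} (c : ℂ) (hf : IsHolo f) : IsHolo (c • f) := by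
  unfold IsHolo
  rw [toPlane_smul]
  exact DifferentiableOn.const_smul hf c

theorem D_zero : D 0 = 0 := by
  funext z
  unfold D
  rw [toPlane_zero]
  exact deriv_const (z : ℂ) (0 : ℂ)

theorem D_add {f g : 𝔻 → ℂ} (hf : IsHolo f) (hg : IsHolo g) : D (f + g) = D f + D g := by
  funext z
  unfold D
  rw [toPlane_add]
  exact deriv_add (hf.differentiableAt z) (hg.differentiableAt z)

theorem D_smul (c : ℂ) {f : 𝔻 → ℂ} (hf : IsHolo f) : D (c • f) = c • D f := by
  funext z
  unfold D
  rw [toPlane_smul]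
  exact deriv_const_smul c (hf.differentiableAt z)

theorem eq_zero_of_D_eq_zero {f : 𝔻 → ℂ} (hf : IsHolo f) (h0 : f 0 = 0) (h : D f = 0) :
    f = 0 := by
  funext z
  have key := (convex_ball (0 : ℂ) 1).is_const_of_fderivWithin_eq_zero (𝕜 := ℂ) hf
    (fun w hw => by
      lift w to 𝔻 using mem_ball_zero_iff.1 hw
      rw [fderivWithin_of_isOpen Metric.isOpen_ball hw]
      ext
      have := congrFun h w
      simpa [D] using this)
    (coe_mem_ball z) (coe_mem_ball 0)
  rw [toPlane_coe, toPlane_coe, h0] at key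
  exact key

theorem weight_nonneg (f : 𝔻 → ℂ) (z : 𝔻) : 0 ≤ weight f z :=
  mul_nonneg (sub_nonneg.2 z.sq_norm_lt_one.le) (norm_nonneg _)

theorem weight_zero (z : 𝔻) : weight 0 z = 0 := by
  simp [weight, D_zero]

theorem weight_add_le {f g : 𝔻 → ℂ} (hf : IsHolo f) (hg : IsHolo g) (z : 𝔻) :
    weight (f + g) z ≤ weight f z + weight g z := by
  unfold weight
  rw [D_add hf hg, D_add hf.D hg.D, ← mul_add]
  exact mul_le_mul_of_nonneg_left (norm_add_le _ _) (sub_nonneg.2 z.sq_norm_lt_one.le)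

theorem weight_smul (c : ℂ) {f : 𝔻 → ℂ} (hf : IsHolo f) (z : 𝔻) :
    weight (c • f) z = ‖c‖ * weight f z := by
  unfold weight
  rw [D_smul c hf, D_smul c hf.D, Pi.smul_apply, norm_smul]
  ring

/-- The Zygmund space as a vector space of functions on the open unit disc. -/
def zygmund : Submodule ℂ (𝔻 → ℂ) where
  carrier := {f | IsHolo f ∧ ExtendsToBoundary f ∧ BddAbove (Set.range (weight f))}
  zero_mem' := by
    refine ⟨IsHolo.zero, ⟨0, continuousOn_const, fun _ => rfl⟩, 0, ?_⟩
    rintro _ ⟨z, rfl⟩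
    exact (weight_zero z).le
  add_mem' := by
    rintro f g ⟨hf, ⟨F, hF, hFf⟩, A, hA⟩ ⟨hg, ⟨G, hG, hGg⟩, B, hB⟩
    refine ⟨hf.add hg, ⟨F + G, hF.add hG, fun z => by simp [hFf, hGg]⟩, A + B, ?_⟩
    rintro _ ⟨z, rfl⟩
    exact (weight_add_le hf hg z).trans (add_le_add (hA ⟨z, rfl⟩) (hB ⟨z, rfl⟩))
  smul_mem' := by
    rintro c f ⟨hf, ⟨F, hF, hFf⟩, A, hA⟩
    refine ⟨hf.smul c, ⟨c • F, hF.const_smul c, fun z => by simp [hFf]⟩, ‖c‖ * A, ?_⟩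
    rintro _ ⟨z, rfl⟩
    rw [weight_smul c hf]
    exact mul_le_mul_of_nonneg_left (hA ⟨z, rfl⟩) (norm_nonneg c)

/-- The Zygmund space as a type of its own, so that it carries the Zygmund norm below and not the
topology of pointwise convergence. -/
def ZygmundSpace : Type := ↥zygmund

instance : AddCommGroup ZygmundSpace := inferInstanceAs (AddCommGroup ↥zygmund)

instance : Module ℂ ZygmundSpace := inferInstanceAs (Module ℂ ↥zygmund)

/-- The underlying function on the open unit disc. -/
def ZygmundSpace.toFun (f : ZygmundSpace) : 𝔻 → ℂ := Subtype.val f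

instance : CoeFun ZygmundSpace (fun _ => 𝔻 → ℂ) := ⟨ZygmundSpace.toFun⟩

/-- The Zygmund norm `|f(0)| + |f'(0)| + sup_{|z|<1} (1 - |z|^2) |f''(z)|`. -/
instance : Norm ZygmundSpace :=
  ⟨fun f => ‖f 0‖ + ‖D f 0‖ + ⨆ z : 𝔻, weight f z⟩

theorem norm_def (f : ZygmundSpace) :
    ‖f‖ = ‖f 0‖ + ‖D f 0‖ + ⨆ z : 𝔻, weight f z := rfl

theorem isHolo (f : ZygmundSpace) : IsHolo f := f.2.1

theorem bddAbove (f : ZygmundSpace) : BddAbove (Set.range (weight f)) := f.2.2.2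

theorem coe_add (f g : ZygmundSpace) : (f + g).toFun = f.toFun + g.toFun := rfl

theorem coe_smul (c : ℂ) (f : ZygmundSpace) : (c • f).toFun = c • f.toFun := rfl

theorem coe_zero : (0 : ZygmundSpace).toFun = 0 := rfl

theorem normedSpaceCore : NormedSpace.Core ℂ ZygmundSpace where
  norm_nonneg f := by
    rw [norm_def]
    have := Real.iSup_nonneg (weight_nonneg f)
    positivity
  norm_smul c f := by
    have h : weight (c • f).toFun = fun z => ‖c‖ * weight f z :=
      funext (weight_smul c (isHolo f))
    rw [norm_def, norm_def, h, ← Real.mul_iSup_of_nonneg (norm_nonneg c), coe_smul,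
      D_smul c (isHolo f), Pi.smul_apply, Pi.smul_apply, norm_smul, norm_smul]
    ring
  norm_triangle f g := by
    have h : (⨆ z : 𝔻, weight (f + g).toFun z) ≤
        (⨆ z : 𝔻, weight f z) + ⨆ z : 𝔻, weight g z :=
      ciSup_le fun z => (weight_add_le (isHolo f) (isHolo g) z).trans
        (add_le_add (le_ciSup (bddAbove f) z) (le_ciSup (bddAbove g) z))
    have h0 := norm_add_le (f 0) (g 0)
    have h1 := norm_add_le (D f 0) (D g 0)
    rw [norm_def, norm_def, norm_def, coe_add, D_add (isHolo f) (isHolo g), Pi.add_apply,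
      Pi.add_apply]
    rw [coe_add] at h
    linarith
  norm_eq_zero_iff f := by
    constructor
    · intro h
      rw [norm_def] at h
      have h2 := Real.iSup_nonneg (weight_nonneg f)
      have h0 := norm_nonneg (f 0)
      have h1 := norm_nonneg (D f 0)
      have e0 : f 0 = 0 := norm_eq_zero.1 (by linarith)
      have e1 : D f 0 = 0 := norm_eq_zero.1 (by linarith)
      have e2 : D (D f) = 0 := by
        funext z
        have hz : weight f z ≤ 0 := (le_ciSup (bddAbove f) z).trans (by linarith)
        have hz' : weight f z = 0 := le_antisymm hz (weight_nonneg f z)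
        rcases mul_eq_zero.1 hz' with h | h
        · exact absurd h (sub_pos.2 z.sq_norm_lt_one).ne'
        · exact norm_eq_zero.1 h
      exact Subtype.ext (eq_zero_of_D_eq_zero (isHolo f) e0
        (eq_zero_of_D_eq_zero (isHolo f).D e1 e2))
    · rintro rfl
      have : weight (0 : 𝔻 → ℂ) = fun _ => 0 := funext weight_zero
      rw [norm_def, coe_zero, D_zero, this]
      simp

instance : NormedAddCommGroup ZygmundSpace := NormedAddCommGroup.ofCore normedSpaceCore

instance : NormedSpace ℂ ZygmundSpace := NormedSpace.ofCore normedSpaceCore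

/-- `(1 - |z|^2) |f''(z)| → 0` as `|z| → 1⁻`. -/
def VanishesAtBoundary (f : 𝔻 → ℂ) : Prop :=
  Filter.Tendsto (weight f) (Filter.comap (fun z : 𝔻 => ‖(z : ℂ)‖) (𝓝[<] (1 : ℝ))) (𝓝 0)

/-- The little Zygmund space `𝒵₀`, a subspace of the Zygmund space. -/
def littleZygmund : Submodule ℂ ZygmundSpace where
  carrier := {f | VanishesAtBoundary f}
  zero_mem' := by
    have : weight (0 : 𝔻 → ℂ) = fun _ => 0 := funext weight_zero
    change Filter.Tendsto (weight (0 : 𝔻 → ℂ)) _ _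
    rw [this]
    exact tendsto_const_nhds
  add_mem' := by
    intro f g hf hg
    have h := Filter.Tendsto.add hf hg
    rw [add_zero] at h
    exact squeeze_zero (weight_nonneg _) (weight_add_le (isHolo f) (isHolo g)) h
  smul_mem' := by
    intro c f hf
    have h := Filter.Tendsto.const_mul ‖c‖ hf
    rw [mul_zero] at h
    exact h.congr fun z => (weight_smul c (isHolo f) z).symm

/-- The subspace `𝒵₀^{(0,1)}` of the little Zygmund space of all `f` with `f(0) = f'(0) = 0`,
with the Zygmund norm. -/
def littleZygmund01 : Submodule ℂ ZygmundSpace where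
  carrier := {f | f ∈ littleZygmund ∧ f 0 = 0 ∧ D f 0 = 0}
  zero_mem' := ⟨littleZygmund.zero_mem, rfl, congrFun D_zero 0⟩
  add_mem' := by
    rintro f g ⟨hf, hf0, hf1⟩ ⟨hg, hg0, hg1⟩
    refine ⟨littleZygmund.add_mem hf hg, ?_, ?_⟩
    · rw [coe_add, Pi.add_apply, hf0, hg0, add_zero]
    · rw [coe_add, D_add (isHolo f) (isHolo g), Pi.add_apply, hf1, hg1, add_zero]
  smul_mem' := by
    rintro c f ⟨hf, hf0, hf1⟩
    refine ⟨littleZygmund.smul_mem c hf, ?_, ?_⟩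
    · rw [coe_smul, Pi.smul_apply, hf0, smul_zero]
    · rw [coe_smul, D_smul c (isHolo f), Pi.smul_apply, hf1, smul_zero]

instance : CoeFun ↥littleZygmund01 (fun _ => 𝔻 → ℂ) := ⟨fun f => ZygmundSpace.toFun f.1⟩

end Zygmund

end

namespace Zygmund

open Metric Set Filter ComplexConjugate

/-! Since `f(0) = f'(0) = 0`, the map `f ↦ f''` identifies `𝒵₀^{(0,1)}` isometrically with the
holomorphic `g` for which `(1 - |z|²)|g(z)|` tends to `0` at the boundary, normed by the supremum of
this weight. Surjectivity (`exists_D_D_eq`) holds because bounded weight already forces continuous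
extension to the closed disc. In this model the formula for `T` reads `g ↦ e^{iα} σ' · (g ∘ σ)`,
which is a surjective isometry because automorphisms give equality in the Schwarz-Pick inequality.

Conversely, an isometry `S` must carry point weights to point weights: for each `a` some `b`
satisfies `weight (S f) b = weight f a` for all `f` (`exists_weight_eq_weight`). A Möbius change of
variable reduces this to `a = 0`. There the function with `f'' = 1` peaks, and norm attainment,
equality in the triangle inequality and compactness give one point `b` common to all peaking
functions (`exists_common_peak`). Perturbing the peaking function shows that `(S h)''(b)` depends
only on `h''(0)`.

Applied to `T⁻¹` and `T`, this gives mutually inverse maps of the disc. They are holomorphic, as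
quotients of second derivatives of images, and `T` acts as a weighted composition. Schwarz-Pick
equality makes the weight a unimodular function times `σ'`; by the maximum principle that function
is constant. -/

/-! ### Calculus for functions on the disc -/

theorem isHolo_iff {f : 𝔻 → ℂ} :
    IsHolo f ↔ ∀ z : 𝔻, DifferentiableAt ℂ (toPlane f) (z : ℂ) := by
  refine ⟨fun h z => h.differentiableAt z, fun h z hz => ?_⟩
  lift z to 𝔻 using mem_ball_zero_iff.1 hz
  exact (h z).differentiableWithinAt

theorem hasDerivAt_D {f : 𝔻 → ℂ} (hf : IsHolo f) (z : 𝔻) :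
    HasDerivAt (toPlane f) (D f z) (z : ℂ) :=
  (hf.differentiableAt z).hasDerivAt

theorem isHolo_of_hasDerivAt {f f' : 𝔻 → ℂ}
    (h : ∀ z : 𝔻, HasDerivAt (toPlane f) (f' z) (z : ℂ)) : IsHolo f :=
  isHolo_iff.2 fun z => (h z).differentiableAt

theorem D_eq_of_hasDerivAt {f f' : 𝔻 → ℂ}
    (h : ∀ z : 𝔻, HasDerivAt (toPlane f) (f' z) (z : ℂ)) : D f = f' :=
  funext fun z => (h z).deriv

theorem toPlane_eventuallyEq {f : 𝔻 → ℂ} {F : ℂ → ℂ} (h : ∀ z : 𝔻, F z = f z) (z : 𝔻) :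
    toPlane f =ᶠ[𝓝 (z : ℂ)] F := by
  filter_upwards [isOpen_ball.mem_nhds (coe_mem_ball z)] with w hw
  lift w to 𝔻 using mem_ball_zero_iff.1 hw
  rw [toPlane_coe, h]

theorem hasDerivAt_toPlane {f : 𝔻 → ℂ} {F : ℂ → ℂ} {c : ℂ} (h : ∀ z : 𝔻, F z = f z) {z : 𝔻}
    (hF : HasDerivAt F c z) : HasDerivAt (toPlane f) c (z : ℂ) :=
  hF.congr_of_eventuallyEq (toPlane_eventuallyEq h z)

theorem isHolo_of_differentiableOn {f : 𝔻 → ℂ} {F : ℂ → ℂ} (h : ∀ z : 𝔻, F z = f z)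
    (hF : DifferentiableOn ℂ F (ball 0 1)) : IsHolo f :=
  isHolo_of_hasDerivAt fun z => hasDerivAt_toPlane h
    (hF.differentiableAt (isOpen_ball.mem_nhds (coe_mem_ball z))).hasDerivAt

theorem IsHolo.continuous {f : 𝔻 → ℂ} (hf : IsHolo f) : Continuous f := by
  have : f = fun z : 𝔻 => toPlane f z := funext fun z => (toPlane_coe f z).symm
  rw [this, continuous_iff_continuousAt]
  exact fun z => ContinuousAt.comp (hf.differentiableAt z).continuousAt
    Complex.UnitDisc.continuous_coe.continuousAt

theorem hasDerivAt_const (c : ℂ) (z : 𝔻) : HasDerivAt (toPlane fun _ => c) 0 (z : ℂ) :=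
  hasDerivAt_toPlane (fun _ => rfl) (_root_.hasDerivAt_const (z : ℂ) c)

theorem hasDerivAt_coe (z : 𝔻) : HasDerivAt (toPlane fun z => (z : ℂ)) 1 (z : ℂ) :=
  hasDerivAt_toPlane (fun _ => rfl) (hasDerivAt_id (z : ℂ))

theorem IsHolo.const (c : ℂ) : IsHolo fun _ => c := isHolo_of_hasDerivAt (hasDerivAt_const c)

theorem D_const (c : ℂ) : D (fun _ => c) = 0 := D_eq_of_hasDerivAt (hasDerivAt_const c)

theorem IsHolo.coe : IsHolo fun z => (z : ℂ) := isHolo_of_hasDerivAt hasDerivAt_coe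

theorem IsHolo.mul {f g : 𝔻 → ℂ} (hf : IsHolo f) (hg : IsHolo g) : IsHolo (f * g) :=
  isHolo_of_differentiableOn (F := toPlane f * toPlane g) (fun z => by simp [toPlane_coe])
    (DifferentiableOn.mul hf hg)

theorem IsHolo.div {f g : 𝔻 → ℂ} (hf : IsHolo f) (hg : IsHolo g) (h : ∀ z, g z ≠ 0) :
    IsHolo (f / g) :=
  isHolo_of_differentiableOn (F := toPlane f / toPlane g) (fun z => by simp [toPlane_coe])
    (DifferentiableOn.div hf hg fun z hz => by
      lift z to 𝔻 using mem_ball_zero_iff.1 hz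
      rw [toPlane_coe]
      exact h z)

theorem IsHolo.sub {f g : 𝔻 → ℂ} (hf : IsHolo f) (hg : IsHolo g) : IsHolo (f - g) := by
  rw [sub_eq_add_neg, ← neg_one_smul ℂ g]
  exact hf.add (hg.smul _)

theorem D_sub {f g : 𝔻 → ℂ} (hf : IsHolo f) (hg : IsHolo g) : D (f - g) = D f - D g := by
  rw [sub_eq_add_neg, ← neg_one_smul ℂ g, D_add hf (hg.smul _), D_smul _ hg, neg_one_smul,
    ← sub_eq_add_neg]

theorem hasDerivAt_toPlane_comp {f : 𝔻 → ℂ} {σ : 𝔻 → 𝔻} (hf : IsHolo f)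
    (hσ : IsHolo fun z => (σ z : ℂ)) (z : 𝔻) :
    HasDerivAt (toPlane fun z => f (σ z)) (D (fun z => (σ z : ℂ)) z * D f (σ z)) (z : ℂ) := by
  have h : HasDerivAt (toPlane f) (D f (σ z)) (toPlane (fun w : 𝔻 => (σ w : ℂ)) z) := by
    rw [toPlane_coe]
    exact hasDerivAt_D hf (σ z)
  have := h.comp (z : ℂ) (hasDerivAt_D hσ z)
  rw [mul_comm]
  exact hasDerivAt_toPlane (fun z => by simp [toPlane_coe]) this

theorem IsHolo.comp {f : 𝔻 → ℂ} {σ : 𝔻 → 𝔻} (hf : IsHolo f)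
    (hσ : IsHolo fun z => (σ z : ℂ)) : IsHolo fun z => f (σ z) :=
  isHolo_of_hasDerivAt (hasDerivAt_toPlane_comp hf hσ)

theorem D_comp {f : 𝔻 → ℂ} {σ : 𝔻 → 𝔻} (hf : IsHolo f)
    (hσ : IsHolo fun z => (σ z : ℂ)) (z : 𝔻) :
    D (fun z => f (σ z)) z = D (fun z => (σ z : ℂ)) z * D f (σ z) :=
  congrFun (D_eq_of_hasDerivAt (hasDerivAt_toPlane_comp hf hσ)) z

theorem eq_of_D_eq {f g : 𝔻 → ℂ} (hf : IsHolo f) (hg : IsHolo g) (h0 : f 0 = g 0)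
    (h : D f = D g) : f = g :=
  sub_eq_zero.1 <| eq_zero_of_D_eq_zero (hf.sub hg) (by simp [h0])
    (by rw [D_sub hf hg, h, sub_self])

theorem eq_of_D_D_eq {f g : 𝔻 → ℂ} (hf : IsHolo f) (hg : IsHolo g) (h0 : f 0 = g 0)
    (h1 : D f 0 = D g 0) (h : D (D f) = D (D g)) : f = g :=
  eq_of_D_eq hf hg h0 (eq_of_D_eq hf.D hg.D h1 h)

theorem exists_primitive {g : 𝔻 → ℂ} (hg : IsHolo g) :
    ∃ G : 𝔻 → ℂ, IsHolo G ∧ G 0 = 0 ∧ D G = g := by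
  obtain ⟨F, hF0, hF⟩ := (DifferentiableOn.isExactOn_ball hg).with_val_at 0 0
  have h (z : 𝔻) : HasDerivAt (toPlane fun z => F z) (g z) (z : ℂ) := by
    have := hF z (coe_mem_ball z)
    rw [toPlane_coe] at this
    exact hasDerivAt_toPlane (fun _ => rfl) this
  exact ⟨fun z => F z, isHolo_of_hasDerivAt h, by simpa using hF0, D_eq_of_hasDerivAt h⟩

theorem norm_ofReal_mul_coe_lt {t : ℝ} (ht : t ∈ Icc (0 : ℝ) 1) (z : 𝔻) :
    ‖(t : ℂ) * z‖ < 1 := by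
  rw [norm_mul, Complex.norm_real, Real.norm_of_nonneg ht.1]
  exact (mul_le_of_le_one_left (norm_nonneg _) ht.2).trans_lt z.norm_lt_one

/-- The derivative of a holomorphic function along a radius. -/
theorem hasDerivAt_radial {G : 𝔻 → ℂ} (hG : IsHolo G) (z : 𝔻) {t : ℝ}
    (ht : t ∈ Icc (0 : ℝ) 1) :
    HasDerivAt (fun t : ℝ => toPlane G (t * z)) (toPlane (D G) (t * z) * z) t := by
  have hmem : (t : ℂ) * z ∈ ball (0 : ℂ) 1 := mem_ball_zero_iff.2 (norm_ofReal_mul_coe_lt ht z)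
  have h1 : HasDerivAt (toPlane G) (toPlane (D G) (t * z)) ((t : ℂ) * z) := by
    rw [toPlane_D_eqOn G hmem]
    exact (DifferentiableOn.differentiableAt hG (isOpen_ball.mem_nhds hmem)).hasDerivAt
  have h2 : HasDerivAt (fun t : ℝ => (t : ℂ) * z) (z : ℂ) t := by
    simpa using (Complex.ofRealCLM.hasDerivAt (x := t)).mul_const (z : ℂ)
  exact h1.comp t h2

theorem integralFromZero_D {G : 𝔻 → ℂ} (hG : IsHolo G) (h0 : G 0 = 0) (z : 𝔻) :
    integralFromZero (D G) z = G z := by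
  unfold integralFromZero
  rw [intervalIntegral.integral_eq_sub_of_hasDerivAt (f := fun t : ℝ => toPlane G (t * z))]
  · have := toPlane_coe G 0
    simp only [Complex.UnitDisc.coe_zero] at this
    simp [toPlane_coe, this, h0]
  · intro t ht
    rw [uIcc_of_le zero_le_one] at ht
    exact hasDerivAt_radial hG z ht
  · apply ContinuousOn.intervalIntegrable
    rw [uIcc_of_le zero_le_one]
    refine ContinuousOn.mul (ContinuousOn.comp (DifferentiableOn.continuousOn hG.D)
      (by fun_prop) ?_) continuousOn_const
    intro t ht
    exact mem_ball_zero_iff.2 (norm_ofReal_mul_coe_lt ht z)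

/-! ### The boundary limit as a limit along the cocompact filter -/

theorem isCompact_setOf_norm_le {r : ℝ} (hr : r < 1) : IsCompact {z : 𝔻 | ‖(z : ℂ)‖ ≤ r} := by
  rw [Complex.UnitDisc.isEmbedding_coe.isCompact_iff]
  convert isCompact_closedBall (0 : ℂ) r using 1
  ext w
  simp only [mem_image, mem_ofPred_eq, mem_closedBall_zero_iff]
  constructor
  · rintro ⟨z, hz, rfl⟩
    exact hz
  · intro hw
    exact ⟨.mk w (hw.trans_lt hr), by simpa using hw, by simp⟩

theorem comap_norm_nhdsLT_one :
    comap (fun z : 𝔻 => ‖(z : ℂ)‖) (𝓝[<] (1 : ℝ)) = cocompact 𝔻 := by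
  ext s
  constructor
  · rintro ⟨u, hu, hus⟩
    obtain ⟨r, hr, hru⟩ := (mem_nhdsLT_iff_exists_Ioo_subset' zero_lt_one).1 hu
    refine mem_cocompact.2 ⟨_, isCompact_setOf_norm_le hr,
    fun z hz => hus (hru ⟨?_, z.norm_lt_one⟩)⟩
    simpa using hz
  · intro hs
    obtain ⟨K, hK, hKs⟩ := mem_cocompact.1 hs
    rcases K.eq_empty_or_nonempty with rfl | hne
    · rw [compl_empty, univ_subset_iff] at hKs
      rw [hKs]
      exact univ_mem
    · obtain ⟨a, -, ha⟩ := hK.exists_isMaxOn hne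
        (Complex.UnitDisc.continuous_coe.norm.continuousOn)
      refine ⟨Ioo ‖(a : ℂ)‖ 1, Ioo_mem_nhdsLT a.norm_lt_one, fun z hz => hKs fun hzK => ?_⟩
      exact (ha hzK).not_gt hz.1

theorem vanishesAtBoundary_iff {f : 𝔻 → ℂ} :
    VanishesAtBoundary f ↔ Tendsto (weight f) (cocompact 𝔻) (𝓝 0) := by
  rw [VanishesAtBoundary, comap_norm_nhdsLT_one]

theorem IsHolo.continuous_weight {f : 𝔻 → ℂ} (hf : IsHolo f) : Continuous (weight f) := by
  unfold weight
  have := hf.D.D.continuous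
  have := Complex.UnitDisc.continuous_coe
  fun_prop

/-- If the weight is positive somewhere, it drops below that value off a compact set, so continuity
gives a maximum; otherwise it vanishes identically. -/
theorem VanishesAtBoundary.exists_isMax {f : 𝔻 → ℂ} (hf : IsHolo f) (h : VanishesAtBoundary f) :
    ∃ z, ∀ w, weight f w ≤ weight f z := by
  by_cases h0 : ∃ z, 0 < weight f z
  · obtain ⟨z, hz⟩ := h0
    exact hf.continuous_weight.exists_forall_ge' z
      (((vanishesAtBoundary_iff.1 h).eventually_lt_const hz).mono fun _ => le_of_lt)
  · push Not at h0
    exact ⟨0, fun w => (h0 w).trans (weight_nonneg f 0)⟩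

/-! ### Growth estimates and continuous extension to the closed disc -/

/-- Comparison of the increments of a holomorphic function along a radius with those of a real
function. -/
theorem norm_sub_radial_le {G : 𝔻 → ℂ} (hG : IsHolo G) (z : 𝔻) {s : ℝ} (hs : s ∈ Icc (0 : ℝ) 1)
    {B B' : ℝ → ℝ} (hB : ∀ t ∈ Icc s 1, HasDerivAt B (B' t) t)
    (h : ∀ t ∈ Icc s 1, ‖toPlane (D G) (t * z)‖ * ‖(z : ℂ)‖ ≤ B' t) :
    ‖G z - toPlane G (s * z)‖ ≤ B 1 - B s := by
  have hsub : Icc s 1 ⊆ Icc 0 1 := Icc_subset_Icc_left hs.1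
  have hd (t : ℝ) (ht : t ∈ Icc s 1) :
      HasDerivAt (fun t : ℝ => toPlane G (t * z) - toPlane G (s * z))
        (toPlane (D G) (t * z) * z) t :=
    (hasDerivAt_radial hG z (hsub ht)).sub_const _
  have := image_norm_le_of_norm_deriv_right_le_deriv_boundary' (B := fun t => B t - B s)
    (fun t ht => (hd t ht).continuousAt.continuousWithinAt)
    (fun t ht => (hd t (Ico_subset_Icc_self ht)).hasDerivWithinAt) (by simp)
    (fun t ht => ((hB t ht).sub_const _).continuousAt.continuousWithinAt)
    (fun t ht => ((hB t (Ico_subset_Icc_self ht)).sub_const _).hasDerivWithinAt)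
    (fun t ht => (norm_mul _ _).trans_le (h t (Ico_subset_Icc_self ht)))
    (right_mem_Icc.2 hs.2)
  simpa [toPlane_coe] using this

theorem one_sub_mul_norm_pos {t : ℝ} (ht : t ∈ Icc (0 : ℝ) 1) (z : 𝔻) :
    0 < 1 - t * ‖(z : ℂ)‖ := by
  nlinarith [z.norm_lt_one, norm_nonneg (z : ℂ), ht.1, ht.2]

theorem hasDerivAt_sqrt_one_sub_mul {t : ℝ} (ht : t ∈ Icc (0 : ℝ) 1) (z : 𝔻) :
    HasDerivAt (fun t : ℝ => √(1 - t * ‖(z : ℂ)‖))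
      (-‖(z : ℂ)‖ / (2 * √(1 - t * ‖(z : ℂ)‖))) t := by
  have := ((hasDerivAt_id t).mul_const ‖(z : ℂ)‖).const_sub 1
  rw [one_mul] at this
  exact this.sqrt (one_sub_mul_norm_pos ht z).ne'

theorem toPlane_mul_coe (G : 𝔻 → ℂ) {t : ℝ} (ht : t ∈ Icc (0 : ℝ) 1) (z : 𝔻) :
    toPlane G (t * z) = G (.mk (t * z) (norm_ofReal_mul_coe_lt ht z)) :=
  dif_pos _

/-- Integrates `|f''(w)| ≤ C (1 - |w|)^(-3/2)` along a radius. The exponent `3/2`, weaker than the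
available `1`, avoids logarithms and still leaves an integrable bound for `f'`. -/
theorem norm_D_le {f : 𝔻 → ℂ} (hf : IsHolo f) {C : ℝ} (hC : ∀ z, weight f z ≤ C) (z : 𝔻) :
    ‖D f z‖ ≤ ‖D f 0‖ + 2 * C / √(1 - ‖(z : ℂ)‖) := by
  have hC0 : 0 ≤ C := (weight_nonneg f 0).trans (hC 0)
  have key := norm_sub_radial_le hf.D z (left_mem_Icc.2 zero_le_one)
    (B := fun t => 2 * C * (√(1 - t * ‖(z : ℂ)‖))⁻¹)
    (fun t ht => ((hasDerivAt_sqrt_one_sub_mul ht z).inv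
      (Real.sqrt_pos.2 (one_sub_mul_norm_pos ht z)).ne').const_mul (2 * C)) (by
    intro t ht
    have hp := one_sub_mul_norm_pos ht z
    have hsq := Real.sq_sqrt hp.le
    have hs := Real.sqrt_pos.2 hp
    have hs1 : √(1 - t * ‖(z : ℂ)‖) ≤ 1 :=
      Real.sqrt_le_one.2 (by nlinarith [ht.1, norm_nonneg (z : ℂ)])
    have hw := hC (.mk (t * z) (norm_ofReal_mul_coe_lt ht z))
    rw [weight, ← toPlane_mul_coe (D (D f)) ht, Complex.UnitDisc.coe_mk, norm_mul,
      Complex.norm_real, Real.norm_of_nonneg ht.1] at hw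
    have hx : 0 ≤ t * ‖(z : ℂ)‖ := mul_nonneg ht.1 (norm_nonneg _)
    set s := √(1 - t * ‖(z : ℂ)‖)
    set x := t * ‖(z : ℂ)‖
    have h1 : s ^ 3 * ‖toPlane (D (D f)) (t * z)‖ ≤ C := by
      refine le_trans (mul_le_mul_of_nonneg_right ?_ (norm_nonneg _)) hw
      calc s ^ 3 ≤ s ^ 2 := pow_le_pow_of_le_one hs.le hs1 (by norm_num)
        _ ≤ 1 - x ^ 2 := by nlinarith
    have h2 : ‖toPlane (D (D f)) (t * z)‖ ≤ C / s ^ 3 := by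
      rw [le_div_iff₀ (by positivity)]
      linarith
    calc _ ≤ C / s ^ 3 * ‖(z : ℂ)‖ := mul_le_mul_of_nonneg_right h2 (norm_nonneg _)
      _ = _ := by field_simp)
  have h0 : toPlane (D f) (((0 : ℝ) : ℂ) * z) = D f 0 := by
    have := toPlane_coe (D f) 0
    simpa using this
  rw [h0] at key
  have := norm_le_norm_add_norm_sub' (D f z) (D f 0)
  simp only [zero_mul, sub_zero, Real.sqrt_one, inv_one, one_mul, mul_one] at key
  rw [div_eq_mul_inv]
  linarith

theorem norm_sub_toPlane_mul_le {f : 𝔻 → ℂ} (hf : IsHolo f) {C : ℝ} (hC : ∀ z, weight f z ≤ C)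
    {s : ℝ} (hs : s ∈ Icc (0 : ℝ) 1) (z : 𝔻) :
    ‖f z - toPlane f (s * z)‖ ≤ ‖D f 0‖ * (1 - s) + 4 * C * √(1 - s) := by
  have hC0 : 0 ≤ C := (weight_nonneg f 0).trans (hC 0)
  have key := norm_sub_radial_le hf z hs
    (B := fun t => ‖D f 0‖ * ‖(z : ℂ)‖ * t - 4 * C * √(1 - t * ‖(z : ℂ)‖))
    (fun t ht => ((hasDerivAt_id t).const_mul (‖D f 0‖ * ‖(z : ℂ)‖)).sub
      ((hasDerivAt_sqrt_one_sub_mul ⟨hs.1.trans ht.1, ht.2⟩ z).const_mul (4 * C))) (by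
    intro t ht
    have ht' : t ∈ Icc (0 : ℝ) 1 := ⟨hs.1.trans ht.1, ht.2⟩
    have h := norm_D_le hf hC (.mk (t * z) (norm_ofReal_mul_coe_lt ht' z))
    rw [← toPlane_mul_coe (D f) ht', Complex.UnitDisc.coe_mk, norm_mul,
      Complex.norm_real, Real.norm_of_nonneg ht'.1] at h
    refine (mul_le_mul_of_nonneg_right h (norm_nonneg _)).trans_eq ?_
    have := Real.sqrt_pos.2 (one_sub_mul_norm_pos ht' z)
    field_simp
    ring)
  refine key.trans ?_
  have hz := z.norm_lt_one
  have hz0 := norm_nonneg (z : ℂ)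
  -- Subadditivity of the square root, with `1 - s r ≤ (1 - r) + (1 - s)`. It makes the bound
  -- independent of `z`.
  have h1 : √(1 - s * ‖(z : ℂ)‖) ≤ √(1 - ‖(z : ℂ)‖) + √(1 - s) := by
    have ha := Real.sq_sqrt (sub_nonneg.2 hz.le)
    have hb := Real.sq_sqrt (sub_nonneg.2 hs.2)
    refine Real.sqrt_le_iff.2 ⟨by positivity, ?_⟩
    have := mul_nonneg (Real.sqrt_nonneg (1 - ‖(z : ℂ)‖)) (Real.sqrt_nonneg (1 - s))
    nlinarith [hs.2]
  have h2 : ‖D f 0‖ * ‖(z : ℂ)‖ * (1 - s) ≤ ‖D f 0‖ * (1 - s) :=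
    mul_le_mul_of_nonneg_right (mul_le_of_le_one_right (norm_nonneg _) hz.le) (by linarith [hs.2])
  have h3 := mul_le_mul_of_nonneg_left h1 (by linarith : (0 : ℝ) ≤ 4 * C)
  simp only [one_mul, mul_one]
  linarith

/-- The dilations `z ↦ f(s z)`, `s < 1`, are continuous on the compact closed disc and converge
uniformly to `f` as `s → 1`. -/
theorem uniformContinuousOn_toPlane {f : 𝔻 → ℂ} (hf : IsHolo f) {C : ℝ}
    (hC : ∀ z, weight f z ≤ C) : UniformContinuousOn (toPlane f) (ball 0 1) := by
  have hlim : TendstoUniformlyOn (fun (s : ℝ) z => toPlane f (s * z)) (toPlane f) (𝓝[<] (1 : ℝ))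
      (ball 0 1) := by
    rw [Metric.tendstoUniformlyOn_iff]
    intro ε hε
    have ht : Tendsto (fun s : ℝ => ‖D f 0‖ * (1 - s) + 4 * C * √(1 - s)) (𝓝[<] 1) (𝓝 0) := by
      have : Continuous fun s : ℝ => ‖D f 0‖ * (1 - s) + 4 * C * √(1 - s) := by fun_prop
      simpa using (this.tendsto 1).mono_left nhdsWithin_le_nhds
    filter_upwards [ht.eventually_lt_const hε, Ioo_mem_nhdsLT zero_lt_one] with s hs hs01 z hz
    lift z to 𝔻 using mem_ball_zero_iff.1 hz
    rw [dist_eq_norm, toPlane_coe]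
    exact (norm_sub_toPlane_mul_le hf hC ⟨hs01.1.le, hs01.2.le⟩ z).trans_lt hs
  refine hlim.uniformContinuousOn (Eventually.frequently ?_)
  filter_upwards [Ioo_mem_nhdsLT zero_lt_one] with s hs
  refine UniformContinuousOn.mono
    ((isCompact_closedBall (0 : ℂ) 1).uniformContinuousOn_of_continuous
      (ContinuousOn.comp (DifferentiableOn.continuousOn hf) (by fun_prop) ?_))
    ball_subset_closedBall
  intro z hz
  rw [mem_closedBall_zero_iff] at hz
  rw [mem_ball_zero_iff, norm_mul, Complex.norm_real, Real.norm_of_nonneg hs.1.le]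
  exact (mul_le_of_le_one_right hs.1.le hz).trans_lt hs.2

theorem extendsToBoundary_of_weight_le {f : 𝔻 → ℂ} (hf : IsHolo f) {C : ℝ}
    (hC : ∀ z, weight f z ≤ C) : ExtendsToBoundary f := by
  have hu := uniformContinuousOn_toPlane hf hC
  have hcl : closedBall (0 : ℂ) 1 ⊆ closure (ball 0 1) := (closure_ball (0 : ℂ) one_ne_zero).ge
  refine ⟨extendFrom (ball 0 1) (toPlane f), continuousOn_extendFrom hcl fun x hx => ?_,
    fun z => ?_⟩
  · have : (𝓝[ball (0 : ℂ) 1] x).NeBot := mem_closure_iff_nhdsWithin_neBot.1 (hcl hx)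
    refine CompleteSpace.complete ⟨inferInstance, ?_⟩
    have hc : Cauchy (𝓝[ball (0 : ℂ) 1] x) := cauchy_nhds.mono nhdsWithin_le_nhds
    have hle : 𝓝[ball (0 : ℂ) 1] x ×ˢ 𝓝[ball (0 : ℂ) 1] x ≤
        uniformity ℂ ⊓ 𝓟 (ball 0 1 ×ˢ ball 0 1) :=
      le_inf hc.2 (le_principal_iff.2 (prod_mem_prod self_mem_nhdsWithin self_mem_nhdsWithin))
    rw [prod_map_map_eq]
    exact Tendsto.mono_left hu hle
  · rw [extendFrom_eq (subset_closure (coe_mem_ball z))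
      ((DifferentiableOn.continuousOn hf) z (coe_mem_ball z)), toPlane_coe]

/-! ### Second derivatives determine and realise the elements of `𝒵₀^{(0,1)}` -/

theorem littleZygmund01_ext {f g : littleZygmund01} (h : D (D f) = D (D g)) : f = g :=
  Subtype.ext <| Subtype.ext <| eq_of_D_D_eq (isHolo f.1) (isHolo g.1) (f.2.2.1.trans g.2.2.1.symm)
    (f.2.2.2.trans g.2.2.2.symm) h

/-- Every holomorphic `g` with `(1 - |z|^2) |g(z)| → 0` at the boundary is a second derivative of
an element of `𝒵₀^{(0,1)}`. -/
theorem exists_D_D_eq {g : 𝔻 → ℂ} (hg : IsHolo g)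
    (h : Tendsto (fun z : 𝔻 => (1 - ‖(z : ℂ)‖ ^ 2) * ‖g z‖) (cocompact 𝔻) (𝓝 0)) :
    ∃ f : littleZygmund01, D (D f) = g := by
  obtain ⟨f₁, hf₁, h₁, rfl⟩ := exists_primitive hg
  obtain ⟨f, hf, h₀, rfl⟩ := exists_primitive hf₁
  have hv : VanishesAtBoundary f := vanishesAtBoundary_iff.2 h
  obtain ⟨z, hz⟩ := hv.exists_isMax hf
  exact ⟨⟨⟨f, hf, extendsToBoundary_of_weight_le hf hz, ⟨_, forall_mem_range.2 hz⟩⟩, hv,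
    h₀, h₁⟩, rfl⟩

/-! ### Möbius involutions and Schwarz-Pick -/

theorem one_sub_conj_mul_ne_zero (a z : 𝔻) : 1 - conj (a : ℂ) * z ≠ 0 := by
  intro h
  have h1 : ‖conj (a : ℂ) * z‖ = 1 := by rw [← sub_eq_zero.1 h, norm_one]
  rw [norm_mul, RCLike.norm_conj] at h1
  nlinarith [a.norm_lt_one, z.norm_lt_one, norm_nonneg (a : ℂ), norm_nonneg (z : ℂ)]

theorem one_sub_sq_norm_pos (z : 𝔻) : 0 < 1 - ‖(z : ℂ)‖ ^ 2 := sub_pos.2 z.sq_norm_lt_one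

theorem one_sub_sq_norm_mobius (a z : 𝔻) :
    1 - ‖((a : ℂ) - z) / (1 - conj (a : ℂ) * z)‖ ^ 2 =
      (1 - ‖(a : ℂ)‖ ^ 2) * (1 - ‖(z : ℂ)‖ ^ 2) / ‖1 - conj (a : ℂ) * z‖ ^ 2 := by
  have h : ‖1 - conj (a : ℂ) * z‖ ≠ 0 := norm_ne_zero_iff.2 (one_sub_conj_mul_ne_zero a z)
  rw [norm_div, div_pow, eq_div_iff (pow_ne_zero 2 h), sub_mul, div_mul_cancel₀ _ (pow_ne_zero 2 h)]
  simp only [← Complex.normSq_eq_norm_sq, Complex.normSq_apply, Complex.sub_re, Complex.sub_im,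
    Complex.mul_re, Complex.mul_im, Complex.conj_re, Complex.conj_im, Complex.one_re,
    Complex.one_im]
  ring

theorem norm_mobius_lt_one (a z : 𝔻) : ‖((a : ℂ) - z) / (1 - conj (a : ℂ) * z)‖ < 1 := by
  have h : 0 < ‖1 - conj (a : ℂ) * z‖ := norm_pos_iff.2 (one_sub_conj_mul_ne_zero a z)
  have : 0 < 1 - ‖((a : ℂ) - z) / (1 - conj (a : ℂ) * z)‖ ^ 2 := by
    rw [one_sub_sq_norm_mobius]
    have := one_sub_sq_norm_pos a
    have := one_sub_sq_norm_pos z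
    positivity
  exact lt_of_pow_lt_pow_left₀ 2 zero_le_one (by linarith)

/-- The disc automorphism `z ↦ (a - z) / (1 - conj a * z)`, an involution exchanging `0` and `a`. -/
noncomputable def mobius (a z : 𝔻) : 𝔻 := .mk _ (norm_mobius_lt_one a z)

theorem coe_mobius (a z : 𝔻) :
    (mobius a z : ℂ) = ((a : ℂ) - z) / (1 - conj (a : ℂ) * z) := rfl

theorem mobius_zero (a : 𝔻) : mobius a 0 = a :=
  Complex.UnitDisc.coe_injective (by simp [coe_mobius])

theorem mobius_self (a : 𝔻) : mobius a a = 0 :=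
  Complex.UnitDisc.coe_injective (by simp [coe_mobius])

theorem one_sub_conj_mul_self (a : 𝔻) :
    1 - conj (a : ℂ) * a = ((1 - ‖(a : ℂ)‖ ^ 2 : ℝ) : ℂ) := by
  rw [← Complex.normSq_eq_conj_mul_self, Complex.normSq_eq_norm_sq]
  push_cast
  ring

theorem mobius_involutive (a : 𝔻) : Function.Involutive (mobius a) := by
  intro z
  apply Complex.UnitDisc.coe_injective
  have h1 := one_sub_conj_mul_ne_zero a z
  have h2 := one_sub_conj_mul_ne_zero a (mobius a z)
  rw [coe_mobius a (mobius a z), div_eq_iff h2, coe_mobius]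
  generalize hd : 1 - conj (a : ℂ) * z = d at h1
  field_simp
  rw [← hd]
  ring

theorem hasDerivAt_mobius (a z : 𝔻) :
    HasDerivAt (toPlane fun z => (mobius a z : ℂ))
      (-(1 - conj (a : ℂ) * a) / (1 - conj (a : ℂ) * z) ^ 2) (z : ℂ) := by
  have h := one_sub_conj_mul_ne_zero a z
  refine hasDerivAt_toPlane (F := fun z => ((a : ℂ) - z) / (1 - conj (a : ℂ) * z))
    (fun _ => rfl) ?_
  refine HasDerivAt.congr_deriv (((hasDerivAt_id (z : ℂ)).const_sub (a : ℂ)).div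
    (((hasDerivAt_id (z : ℂ)).const_mul (conj (a : ℂ))).const_sub 1) h) ?_
  simp only [id]
  ring

theorem isHolo_mobius (a : 𝔻) : IsHolo fun z => (mobius a z : ℂ) :=
  isHolo_of_hasDerivAt (hasDerivAt_mobius a)

theorem isDiscAutomorphism_mobius (a : 𝔻) : IsDiscAutomorphism (mobius_involutive a).toPerm :=
  ⟨isHolo_mobius a, isHolo_mobius a⟩

theorem norm_D_mobius_zero (a : 𝔻) : ‖D (fun z => (mobius a z : ℂ)) 0‖ = 1 - ‖(a : ℂ)‖ ^ 2 := by
  rw [D_eq_of_hasDerivAt (hasDerivAt_mobius a), one_sub_conj_mul_self, norm_div, norm_neg,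
    Complex.norm_real, Real.norm_of_nonneg (one_sub_sq_norm_pos a).le]
  simp

theorem norm_D_mobius_self (a : 𝔻) :
    ‖D (fun z => (mobius a z : ℂ)) a‖ = (1 - ‖(a : ℂ)‖ ^ 2)⁻¹ := by
  have := one_sub_sq_norm_pos a
  rw [D_eq_of_hasDerivAt (hasDerivAt_mobius a)]
  beta_reduce
  rw [one_sub_conj_mul_self, norm_div, norm_neg, norm_pow, Complex.norm_real,
    Real.norm_of_nonneg this.le]
  field_simp

theorem norm_D_zero_le_one {σ : 𝔻 → 𝔻} (hσ : IsHolo fun z => (σ z : ℂ)) (h0 : σ 0 = 0) :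
    ‖D (fun z => (σ z : ℂ)) 0‖ ≤ 1 := by
  refine Complex.norm_deriv_le_one_of_mapsTo_ball (R := 1) hσ (fun z hz => ?_) zero_lt_one
  lift z to 𝔻 using mem_ball_zero_iff.1 hz
  rw [toPlane_coe, toPlane_coe, h0]
  exact ball_subset_closedBall (coe_mem_ball (σ z))

/-- The **Schwarz-Pick lemma** at a point. -/
theorem norm_D_mul_le {σ : 𝔻 → 𝔻} (hσ : IsHolo fun z => (σ z : ℂ)) (z : 𝔻) :
    (1 - ‖(z : ℂ)‖ ^ 2) * ‖D (fun z => (σ z : ℂ)) z‖ ≤ 1 - ‖(σ z : ℂ)‖ ^ 2 := by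
  -- Composing with involutions on both sides moves `z` and `σ z` to the origin, where the Schwarz
  -- lemma applies.
  have hτ : IsHolo fun w => (mobius (σ z) (σ w) : ℂ) := (isHolo_mobius (σ z)).comp hσ
  have hc : IsHolo fun w => (mobius (σ z) (σ (mobius z w)) : ℂ) := hτ.comp (isHolo_mobius z)
  have h := norm_D_zero_le_one hc (by rw [mobius_zero, mobius_self])
  rw [D_comp (σ := mobius z) hτ (isHolo_mobius z), mobius_zero, D_comp (isHolo_mobius (σ z)) hσ,
    norm_mul, norm_mul, norm_D_mobius_zero, norm_D_mobius_self, ← mul_assoc, ← div_eq_mul_inv,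
    div_le_one (one_sub_sq_norm_pos _)] at h
  exact h

theorem IsDiscAutomorphism.symm {σ : 𝔻 ≃ 𝔻} (hσ : IsDiscAutomorphism σ) :
    IsDiscAutomorphism σ.symm :=
  ⟨hσ.2, hσ.1⟩

theorem IsDiscAutomorphism.D_symm_mul {σ : 𝔻 ≃ 𝔻} (hσ : IsDiscAutomorphism σ) (z : 𝔻) :
    D (fun z => (σ z : ℂ)) z * D (fun z => (σ.symm z : ℂ)) (σ z) = 1 := by
  rw [← D_comp hσ.2 hσ.1]
  simp only [Equiv.symm_apply_apply]
  exact (hasDerivAt_coe z).deriv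

/-- Schwarz-Pick for `σ` gives one inequality; applied to the inverse at `σ z`, together with the
chain rule, it gives the other. -/
theorem IsDiscAutomorphism.norm_D {σ : 𝔻 ≃ 𝔻} (hσ : IsDiscAutomorphism σ) (z : 𝔻) :
    (1 - ‖(z : ℂ)‖ ^ 2) * ‖D (fun z => (σ z : ℂ)) z‖ = 1 - ‖(σ z : ℂ)‖ ^ 2 := by
  refine le_antisymm (norm_D_mul_le hσ.1 z) ?_
  have h := norm_D_mul_le hσ.2 (σ z)
  have h1 := congrArg norm (hσ.D_symm_mul z)
  rw [norm_mul, norm_one] at h1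
  rw [Equiv.symm_apply_apply] at h
  calc 1 - ‖(σ z : ℂ)‖ ^ 2 = (1 - ‖(σ z : ℂ)‖ ^ 2) *
        ‖D (fun z => (σ.symm z : ℂ)) (σ z)‖ * ‖D (fun z => (σ z : ℂ)) z‖ := by
        rw [mul_assoc, mul_comm ‖_‖ ‖_‖, h1, mul_one]
    _ ≤ _ := mul_le_mul_of_nonneg_right h (norm_nonneg _)

theorem IsDiscAutomorphism.continuous {σ : 𝔻 ≃ 𝔻} (hσ : IsDiscAutomorphism σ) : Continuous σ :=
  Complex.UnitDisc.isEmbedding_coe.continuous_iff.2 hσ.1.continuous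

theorem IsDiscAutomorphism.tendsto_cocompact {σ : 𝔻 ≃ 𝔻} (hσ : IsDiscAutomorphism σ) :
    Tendsto σ (cocompact 𝔻) (cocompact 𝔻) :=
  (Homeomorph.mk σ hσ.continuous hσ.symm.continuous).isClosedEmbedding.tendsto_cocompact

/-! ### The weighted supremum norm and weighted composition operators -/

/-- The second derivative, as a linear map. -/
noncomputable def secondDeriv : littleZygmund01 →ₗ[ℂ] (𝔻 → ℂ) where
  toFun f := D (D f)
  map_add' f g := by
    have hf := isHolo f.1
    have hg := isHolo g.1
    rw [← D_add hf.D hg.D, ← D_add hf hg]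
    rfl
  map_smul' c f := by
    have hf := isHolo f.1
    rw [RingHom.id_apply, ← D_smul c hf.D, ← D_smul c hf]
    rfl

theorem secondDeriv_injective : Function.Injective secondDeriv := fun _ _ h => littleZygmund01_ext h

theorem isHolo_secondDeriv (f : littleZygmund01) : IsHolo (secondDeriv f) := (isHolo f.1).D.D

theorem weight_eq (f : littleZygmund01) (z : 𝔻) :
    weight f z = (1 - ‖(z : ℂ)‖ ^ 2) * ‖secondDeriv f z‖ := rfl

theorem norm_eq_iSup (f : littleZygmund01) : ‖f‖ = ⨆ z, weight f z := by
  change ‖f.1‖ = _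
  rw [norm_def, f.2.2.1, f.2.2.2, norm_zero, zero_add, zero_add]

theorem weight_le_norm (f : littleZygmund01) (z : 𝔻) : weight f z ≤ ‖f‖ := by
  rw [norm_eq_iSup]
  exact le_ciSup (bddAbove f.1) z

theorem norm_le_of_weight_le {f : littleZygmund01} {C : ℝ} (h : ∀ z, weight f z ≤ C) : ‖f‖ ≤ C := by
  rw [norm_eq_iSup]
  exact ciSup_le h

theorem tendsto_weight (f : littleZygmund01) : Tendsto (weight f) (cocompact 𝔻) (𝓝 0) :=
  vanishesAtBoundary_iff.1 f.2.1

theorem exists_weight_eq_norm (f : littleZygmund01) : ∃ z, weight f z = ‖f‖ := by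
  obtain ⟨z, hz⟩ := VanishesAtBoundary.exists_isMax (isHolo f.1) f.2.1
  exact ⟨z, le_antisymm (weight_le_norm f z) (norm_le_of_weight_le hz)⟩

theorem norm_eq_norm_of_weight_eq {f g : littleZygmund01} (e : 𝔻 ≃ 𝔻)
    (h : ∀ z, weight g z = weight f (e z)) : ‖g‖ = ‖f‖ := by
  rw [norm_eq_iSup, norm_eq_iSup, ← e.iSup_comp (g := weight f)]
  exact congrArg iSup (funext h)

theorem IsDiscAutomorphism.weight_eq_of_secondDeriv_eq {σ : 𝔻 ≃ 𝔻} (hσ : IsDiscAutomorphism σ)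
    {c : ℂ} (hc : ‖c‖ = 1) {f g : littleZygmund01}
    (h : ∀ z, secondDeriv g z = c * D (fun z => (σ z : ℂ)) z * secondDeriv f (σ z))
    (z : 𝔻) : weight g z = weight f (σ z) := by
  rw [weight_eq, weight_eq, h, norm_mul, norm_mul, hc, one_mul, ← mul_assoc, hσ.norm_D]

theorem IsDiscAutomorphism.exists_secondDeriv_eq {σ : 𝔻 ≃ 𝔻} (hσ : IsDiscAutomorphism σ)
    (f : littleZygmund01) : ∃ g : littleZygmund01, ∀ z,
      secondDeriv g z = D (fun z => (σ z : ℂ)) z * secondDeriv f (σ z) := by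
  obtain ⟨g, hg⟩ := exists_D_D_eq (g := fun z => D (fun z => (σ z : ℂ)) z *
    secondDeriv f (σ z)) (hσ.1.D.mul ((isHolo_secondDeriv f).comp hσ.1)) (by
      refine ((tendsto_weight f).comp hσ.tendsto_cocompact).congr fun z => ?_
      rw [Function.comp_apply, weight_eq, norm_mul, ← mul_assoc, hσ.norm_D])
  exact ⟨g, congrFun hg⟩

/-- The isometry of `𝒵₀^{(0,1)}` given on second derivatives by composition with `σ` and
multiplication by the derivative of `σ`. -/
theorem IsDiscAutomorphism.exists_linearIsometry {σ : 𝔻 ≃ 𝔻} (hσ : IsDiscAutomorphism σ) :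
    ∃ C : littleZygmund01 →ₗᵢ[ℂ] littleZygmund01, ∀ f z,
      secondDeriv (C f) z = D (fun z => (σ z : ℂ)) z * secondDeriv f (σ z) := by
  choose C hC using hσ.exists_secondDeriv_eq
  refine ⟨⟨⟨⟨C, fun f g => ?_⟩, fun c f => ?_⟩, fun f => ?_⟩, hC⟩
  · refine secondDeriv_injective (funext fun z => ?_)
    simp only [map_add, Pi.add_apply, hC]
    ring
  · refine secondDeriv_injective (funext fun z => ?_)
    simp only [map_smul, Pi.smul_apply, hC, smul_eq_mul, RingHom.id_apply]
    ring
  · exact norm_eq_norm_of_weight_eq σ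
      (hσ.weight_eq_of_secondDeriv_eq norm_one fun z => by rw [one_mul]; exact hC f z)

theorem tendsto_one_sub_sq_norm_mul {g : 𝔻 → ℂ} {M : ℝ} (hM : ∀ z, ‖g z‖ ≤ M) :
    Tendsto (fun z : 𝔻 => (1 - ‖(z : ℂ)‖ ^ 2) * ‖g z‖) (cocompact 𝔻) (𝓝 0) := by
  have h : Tendsto (fun z : 𝔻 => (1 - ‖(z : ℂ)‖ ^ 2) * M) (cocompact 𝔻) (𝓝 0) := by
    have hc : Continuous fun r : ℝ => (1 - r ^ 2) * M := by fun_prop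
    have := (hc.tendsto 1).mono_left (nhdsWithin_le_nhds (s := Iio 1))
    rw [← comap_norm_nhdsLT_one]
    exact (by simpa using this : Tendsto (fun r : ℝ => (1 - r ^ 2) * M) (𝓝[<] 1) (𝓝 0)).comp
      tendsto_comap
  exact squeeze_zero (fun z => mul_nonneg (one_sub_sq_norm_pos z).le (norm_nonneg _))
    (fun z => mul_le_mul_of_nonneg_left (hM z) (one_sub_sq_norm_pos z).le) h

theorem exists_secondDeriv_eq_one : ∃ f : littleZygmund01, secondDeriv f = fun _ => 1 :=
  exists_D_D_eq (IsHolo.const 1) (tendsto_one_sub_sq_norm_mul fun _ => norm_one.le)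

theorem exists_secondDeriv_eq_coe : ∃ f : littleZygmund01, secondDeriv f = fun z : 𝔻 => (z : ℂ) :=
  exists_D_D_eq IsHolo.coe (tendsto_one_sub_sq_norm_mul fun z => z.norm_lt_one.le)

/-! ### Isometries carry point weights to point weights -/

/-- A holomorphic function with a double zero at the origin is `O(|z|^2)` near the origin. -/
theorem exists_norm_le_mul_sq {g : 𝔻 → ℂ} (hg : IsHolo g) (h0 : g 0 = 0) (h1 : D g 0 = 0) :
    ∃ M, ∀ z : 𝔻, ‖(z : ℂ)‖ ≤ 1 / 2 → ‖g z‖ ≤ M * ‖(z : ℂ)‖ ^ 2 := by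
  have hb : ball (0 : ℂ) 1 ∈ 𝓝 0 := ball_mem_nhds 0 zero_lt_one
  -- Dividing out `z` twice leaves a holomorphic factor, bounded on the closed disc of radius `1 /
  -- 2`.
  have hd : DifferentiableOn ℂ (dslope (dslope (toPlane g) 0) 0) (ball 0 1) :=
    (Complex.differentiableOn_dslope hb).2 ((Complex.differentiableOn_dslope hb).2 hg)
  obtain ⟨M, hM⟩ := (isCompact_closedBall (0 : ℂ) (1 / 2)).exists_bound_of_continuousOn
    (hd.continuousOn.mono (closedBall_subset_ball (by norm_num)))
  have hG0 : toPlane g 0 = 0 := by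
    have := toPlane_coe g 0
    rwa [h0, Complex.UnitDisc.coe_zero] at this
  have hG1 : deriv (toPlane g) 0 = 0 := h1
  refine ⟨M, fun z hz => ?_⟩
  have e1 := sub_smul_dslope (toPlane g) 0 (z : ℂ)
  have e2 := sub_smul_dslope (dslope (toPlane g) 0) 0 (z : ℂ)
  rw [dslope_same, hG1, sub_zero, sub_zero] at e2
  rw [hG0, ← e2, toPlane_coe, sub_zero, sub_zero] at e1
  rw [← e1, norm_smul, norm_smul, ← mul_assoc, ← sq, mul_comm]
  exact mul_le_mul_of_nonneg_right (hM z (mem_closedBall_zero_iff.2 hz)) (by positivity)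

theorem exists_weight_le_mul_sq {h : littleZygmund01} (h0 : secondDeriv h 0 = 0)
    (h1 : D (secondDeriv h) 0 = 0) : ∃ M > 0, ∀ z : 𝔻, weight h z ≤ M * ‖(z : ℂ)‖ ^ 2 := by
  obtain ⟨M, hM⟩ := exists_norm_le_mul_sq (isHolo_secondDeriv h) h0 h1
  -- For `|z| > 1 / 2` the factor `4` compensates `|z|² ≥ 1 / 4`; the `+ 1` only ensures positivity.
  refine ⟨max M (4 * ‖h‖) + 1, ?_, fun z => ?_⟩
  · have := le_max_right M (4 * ‖h‖)
    positivity [norm_nonneg h]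
  · have hle : M ≤ max M (4 * ‖h‖) + 1 := (le_max_left _ _).trans (by linarith)
    have hle' : 4 * ‖h‖ ≤ max M (4 * ‖h‖) + 1 := (le_max_right _ _).trans (by linarith)
    rcases le_or_gt ‖(z : ℂ)‖ (1 / 2) with hz | hz
    · calc weight h z ≤ 1 * ‖secondDeriv h z‖ :=
            mul_le_mul_of_nonneg_right (sub_le_self _ (sq_nonneg _)) (norm_nonneg _)
        _ ≤ M * ‖(z : ℂ)‖ ^ 2 := by rw [one_mul]; exact hM z hz
        _ ≤ _ := mul_le_mul_of_nonneg_right hle (sq_nonneg _)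
    · have hz2 : 1 / 4 ≤ ‖(z : ℂ)‖ ^ 2 := by nlinarith
      calc weight h z ≤ ‖h‖ := weight_le_norm h z
        _ ≤ 4 * ‖h‖ * ‖(z : ℂ)‖ ^ 2 := by nlinarith [norm_nonneg h]
        _ ≤ _ := mul_le_mul_of_nonneg_right hle' (sq_nonneg _)

/-- Equality in the triangle inequality for vectors of the unit ball of the plane. -/
theorem eq_of_card_add_one_le_norm_add_sum {ι : Type*} {s : Finset ι} {v : ι → ℂ} {v₀ : ℂ}
    (h₀ : ‖v₀‖ ≤ 1) (hv : ∀ i ∈ s, ‖v i‖ ≤ 1) (h : s.card + 1 ≤ ‖v₀ + ∑ i ∈ s, v i‖) :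
    1 ≤ ‖v₀‖ ∧ ∀ i ∈ s, v i = v₀ := by
  classical
  have hsum (t : Finset ι) (ht : t ⊆ s) : ‖∑ i ∈ t, v i‖ ≤ t.card := by
    simpa using norm_sum_le_of_le t fun i hi => hv i (ht hi)
  refine ⟨?_, fun i hi => ?_⟩
  · have := norm_add_le v₀ (∑ i ∈ s, v i)
    linarith [hsum s subset_rfl]
  · rw [← Finset.add_sum_erase s v hi, ← add_assoc] at h
    have h1 := norm_add_le (v₀ + v i) (∑ j ∈ s.erase i, v j)
    have h2 := hsum _ (s.erase_subset i)
    have h3 : ((s.erase i).card : ℝ) + 1 = s.card := by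
      exact_mod_cast Finset.card_erase_add_one hi
    have h4 : 2 ≤ ‖v₀ + v i‖ := by linarith
    -- As `|v₀ + v i| ≥ 2` and both norms are at most `1`, the parallelogram law forces `v₀ = v i`.
    have h5 := parallelogram_law_with_norm ℝ v₀ (v i)
    have h6 : ‖v₀ - v i‖ = 0 := by
      nlinarith [hv i hi, norm_nonneg v₀, norm_nonneg (v i), norm_nonneg (v₀ - v i)]
    exact (sub_eq_zero.1 (norm_eq_zero.1 h6)).symm

/-- For a linear isometry `S`, the functions of norm at most `1` whose second derivative at the
origin is `1` have images whose second derivatives agree at some common point, where their weighted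
moduli are `1`. -/
theorem exists_common_peak (S : littleZygmund01 →ₗᵢ[ℂ] littleZygmund01) {e : littleZygmund01}
    (he : ‖e‖ ≤ 1) (he0 : secondDeriv e 0 = 1) :
    ∃ b, weight (S e) b = 1 ∧ ∀ f : littleZygmund01, ‖f‖ ≤ 1 → secondDeriv f 0 = 1 →
      secondDeriv (S f) b = secondDeriv (S e) b := by
  have hcont (f : littleZygmund01) : Continuous (secondDeriv f) := (isHolo_secondDeriv f).continuous
  have hle {f : littleZygmund01} (hf : ‖f‖ ≤ 1) (z : 𝔻) : weight (S f) z ≤ 1 :=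
    (weight_le_norm _ z).trans (by rwa [S.norm_map])
  have hK : IsCompact {z | 1 ≤ weight (S e) z} := by
    obtain ⟨K, hK, hKs⟩ := mem_cocompact.1
      ((tendsto_weight (S e)).eventually_lt_const zero_lt_one)
    refine hK.of_isClosed_subset
      (isClosed_le continuous_const (isHolo (S e).1).continuous_weight) fun z hz => ?_
    by_contra hzK
    exact not_lt_of_ge (show 1 ≤ weight (S e) z from hz) (hKs hzK)
  -- By compactness, finitely many `f` suffice. Their sum `p` with `e` has norm at least the number
  -- of summands, because of its value at `0`; where `S p` attains its norm, the triangle inequality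
  -- is an equality.
  obtain ⟨b, hb, hb'⟩ := hK.inter_iInter_nonempty
    (fun f : {f : littleZygmund01 // ‖f‖ ≤ 1 ∧ secondDeriv f 0 = 1} =>
      {z | secondDeriv (S f) z = secondDeriv (S e) z})
    (fun f => isClosed_eq (hcont _) (hcont _)) (by
      intro u
      set p : littleZygmund01 := e + ∑ f ∈ u, f.1 with hp
      obtain ⟨z, hz⟩ := exists_weight_eq_norm (S p)
      have hp0 : secondDeriv p 0 = ((u.card + 1 : ℕ) : ℂ) := by
        rw [hp, map_add, map_sum, Pi.add_apply, Finset.sum_apply, he0,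
          Finset.sum_congr rfl fun f _ => f.2.2, Finset.sum_const, nsmul_one]
        push_cast
        ring
      have hpn : (u.card : ℝ) + 1 ≤ ‖p‖ := by
        refine le_trans ?_ (weight_le_norm p 0)
        rw [weight_eq, hp0, Complex.norm_natCast]
        simp
      have hw (f : littleZygmund01) : ‖((1 - ‖(z : ℂ)‖ ^ 2 : ℝ) : ℂ) * secondDeriv (S f) z‖ =
          weight (S f) z := by
        rw [norm_mul, Complex.norm_real, Real.norm_of_nonneg (one_sub_sq_norm_pos z).le, weight_eq]
      obtain ⟨h1, h2⟩ := eq_of_card_add_one_le_norm_add_sum (s := u)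
        (v := fun f => ((1 - ‖(z : ℂ)‖ ^ 2 : ℝ) : ℂ) * secondDeriv (S f) z)
        (v₀ := ((1 - ‖(z : ℂ)‖ ^ 2 : ℝ) : ℂ) * secondDeriv (S e) z)
        ((hw e).trans_le (hle he z)) (fun f _ => (hw f).trans_le (hle f.2.1 z)) (by
          rw [← Finset.mul_sum, ← mul_add]
          have : secondDeriv (S e) z + ∑ f ∈ u, secondDeriv (S f) z = secondDeriv (S p) z := by
            rw [hp, map_add, map_add, map_sum, map_sum, Pi.add_apply, Finset.sum_apply]
          rw [this, hw, hz, S.norm_map]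
          exact hpn)
      rw [hw] at h1
      refine ⟨z, h1, mem_iInter₂.2 fun f hf => ?_⟩
      exact mul_left_cancel₀ (Complex.ofReal_ne_zero.2 (one_sub_sq_norm_pos z).ne') (h2 f hf))
  exact ⟨b, le_antisymm (hle he b) hb, fun f hf hf0 => mem_iInter.1 hb' ⟨f, hf, hf0⟩⟩

/-- Subtracting the Taylor polynomial `c₀ + c₁ z` from `h''` leaves a double zero at `0`. The
double-zero part and the linear part are both sent to functions whose second derivative vanishes at
the common peak `b`, so only `c₀` contributes. -/
theorem exists_weight_eq_weight_zero (S : littleZygmund01 →ₗᵢ[ℂ] littleZygmund01) :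
    ∃ b, ∀ h : littleZygmund01, weight (S h) b = weight h 0 := by
  obtain ⟨e, he⟩ := exists_secondDeriv_eq_one
  obtain ⟨i, hi⟩ := exists_secondDeriv_eq_coe
  have hen : ‖e‖ ≤ 1 := norm_le_of_weight_le fun z => by
    rw [weight_eq, he, norm_one, mul_one]
    exact sub_le_self _ (sq_nonneg _)
  obtain ⟨b, hb, hF⟩ := exists_common_peak S hen (by rw [he])
  have hdouble (h : littleZygmund01) (h0 : secondDeriv h 0 = 0) (h1 : D (secondDeriv h) 0 = 0) :
      secondDeriv (S h) b = 0 := by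
    obtain ⟨M, hM, hM'⟩ := exists_weight_le_mul_sq h0 h1
    have hM0 : (M : ℂ)⁻¹ ≠ 0 := inv_ne_zero (Complex.ofReal_ne_zero.2 hM.ne')
    -- The weight is at most `(1 - |z|²) + |z|² = 1`, so this perturbation of `e` still peaks at `0`
    -- and `hF` applies.
    have hn : ‖e + (M : ℂ)⁻¹ • h‖ ≤ 1 := norm_le_of_weight_le fun z => by
      have hz := one_sub_sq_norm_pos z
      have hz' : M⁻¹ * weight h z ≤ ‖(z : ℂ)‖ ^ 2 := by
        rw [inv_mul_le_iff₀ hM]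
        exact hM' z
      rw [weight_eq] at hz' ⊢
      rw [map_add, map_smul, he, Pi.add_apply, Pi.smul_apply, smul_eq_mul]
      have h2 := norm_add_le 1 ((M : ℂ)⁻¹ * secondDeriv h z)
      rw [norm_one, norm_mul, norm_inv, Complex.norm_real, Real.norm_of_nonneg hM.le] at h2
      have h3 := mul_le_mul_of_nonneg_left h2 hz.le
      linarith
    have := hF _ hn (by simp [he, h0])
    simpa [hM0] using this
  have hlin : secondDeriv (S i) b = 0 := by
    set w : ℝ := 1 - ‖(b : ℂ)‖ ^ 2
    have hw : 0 < w := one_sub_sq_norm_pos b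
    set l := secondDeriv (S e) b
    set d := secondDeriv (S i) b
    have hl : w * ‖l‖ = 1 := hb
    -- The perturbation `e + s • i` raises the norm only to second order in `s`, whereas `d ≠ 0`
    -- would give first-order growth at `b`.
    have hs (s : ℂ) : w * ‖l + s * d‖ ≤ 1 + ‖s‖ ^ 2 := by
      have h1 : w * ‖l + s * d‖ = weight (S (e + s • i)) b := by
        rw [weight_eq, map_add, map_add, map_smul, map_smul]
        rfl
      rw [h1]
      refine (weight_le_norm _ b).trans ?_
      rw [S.norm_map]
      refine norm_le_of_weight_le fun z => ?_
      rw [weight_eq, map_add, map_smul, he, hi, Pi.add_apply, Pi.smul_apply, smul_eq_mul]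
      have hz := one_sub_sq_norm_pos z
      have h2 := norm_add_le 1 (s * (z : ℂ))
      rw [norm_one, norm_mul] at h2
      have h3 := mul_le_mul_of_nonneg_left h2 hz.le
      have := mul_nonneg (norm_nonneg s) (pow_nonneg (norm_nonneg (z : ℂ)) 3)
      nlinarith [sq_nonneg (‖s‖ - ‖(z : ℂ)‖), sq_nonneg ‖s‖, sq_nonneg ‖(z : ℂ)‖]
    have hl0 : l ≠ 0 := by
      rintro h
      simp [h] at hl
    by_contra hd
    have hd0 : 0 < ‖d‖ := norm_pos_iff.2 hd
    have hl1 : 0 < ‖l‖ := norm_pos_iff.2 hl0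
    -- With `t = |d|² / (2 |l|²)` and `s = t l / d`, the left side of `hs` is `1 + t` while `|s|² =
    -- t / 2`, a contradiction.
    have h := hs ((‖d‖ ^ 2 / (2 * ‖l‖ ^ 2) : ℝ) * (l / d))
    rw [mul_assoc, div_mul_cancel₀ l hd, ← one_add_mul, norm_mul, ← Complex.ofReal_one,
      ← Complex.ofReal_add, Complex.norm_real, Real.norm_of_nonneg (by positivity), mul_left_comm,
      hl, norm_mul, Complex.norm_real, Real.norm_of_nonneg (by positivity), norm_div] at h
    have h' : 0 < ‖d‖ ^ 2 / (2 * ‖l‖ ^ 2) := by positivity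
    have h2 : (‖d‖ ^ 2 / (2 * ‖l‖ ^ 2) * (‖l‖ / ‖d‖)) ^ 2 = ‖d‖ ^ 2 / (2 * ‖l‖ ^ 2) / 2 := by
      field_simp
    linarith
  have hDi : D (secondDeriv i) 0 = 1 := by
    rw [hi]
    exact (hasDerivAt_coe 0).deriv
  have hDe : D (secondDeriv e) 0 = 0 := by
    rw [he]
    exact congrFun (D_const 1) 0
  refine ⟨b, fun h => ?_⟩
  set c₀ := secondDeriv h 0
  set c₁ := D (secondDeriv h) 0
  have h2 := hdouble (h - c₀ • e - c₁ • i) (by simp [he, hi, c₀]) (by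
    have hh := isHolo_secondDeriv h
    have hE := (isHolo_secondDeriv e).smul c₀
    have hI := (isHolo_secondDeriv i).smul c₁
    rw [map_sub, map_sub, map_smul, map_smul, D_sub (hh.sub hE) hI, D_sub hh hE,
      D_smul _ (isHolo_secondDeriv e), D_smul _ (isHolo_secondDeriv i)]
    simp [hDi, hDe, c₁])
  simp only [map_sub, map_smul, Pi.sub_apply, Pi.smul_apply, hlin, smul_eq_mul, mul_zero,
    sub_zero] at h2
  rw [weight_eq, sub_eq_zero.1 h2, norm_mul, mul_left_comm, ← weight_eq, hb, weight_eq]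
  simp [c₀]

theorem exists_weight_eq_weight (S : littleZygmund01 →ₗᵢ[ℂ] littleZygmund01) (a : 𝔻) :
    ∃ b, ∀ f : littleZygmund01, weight (S f) b = weight f a := by
  set σ := (mobius_involutive a).toPerm
  have hσ : IsDiscAutomorphism σ := isDiscAutomorphism_mobius a
  obtain ⟨C, hC⟩ := hσ.exists_linearIsometry
  obtain ⟨b, hb⟩ := exists_weight_eq_weight_zero (S.comp C)
  refine ⟨b, fun f => ?_⟩
  -- The operator of an involution is itself an involution, by the chain rule; so `f` can be
  -- recovered after applying the case of the origin to `S.comp C`.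
  have hinv : C (C f) = f := secondDeriv_injective <| funext fun z => by
    rw [hC, hC, ← mul_assoc, show σ (σ z) = z from mobius_involutive a z]
    have : D (fun z => (σ z : ℂ)) z * D (fun z => (σ z : ℂ)) (σ z) = 1 := hσ.D_symm_mul z
    rw [this, one_mul]
  have h := hb (C f)
  rw [LinearIsometry.coe_comp, Function.comp_apply, hinv] at h
  rw [h, hσ.weight_eq_of_secondDeriv_eq norm_one (f := f) fun z => by rw [one_mul]; exact hC f z]
  congr 1
  exact mobius_zero a

/-! ### The integral formula and its second derivative -/

/-- Subtracting `f'(σ(0))` makes the derivative of the integral vanish at `0`, so both sides have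
zero initial data and agree exactly when their second derivatives do. -/
theorem eq_exp_mul_integralFromZero_iff {σ : 𝔻 ≃ 𝔻} (hσ : IsDiscAutomorphism σ) (c : ℂ)
    (f g : littleZygmund01) :
    (∀ z, g z = c * integralFromZero (fun ξ => D f (σ ξ) - D f (σ 0)) z) ↔
      ∀ z, D (D g) z = c * D (fun ξ => (σ ξ : ℂ)) z * D (D f) (σ z) := by
  have hfσ : IsHolo fun ξ => D f (σ ξ) := (isHolo f.1).D.comp hσ.1
  have hk : IsHolo fun ξ => D f (σ ξ) - D f (σ 0) := hfσ.sub (IsHolo.const _)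
  have hDk : D (fun ξ => D f (σ ξ) - D f (σ 0)) =
      fun z => D (fun ξ => (σ ξ : ℂ)) z * D (D f) (σ z) := by
    refine (D_sub hfσ (IsHolo.const _)).trans (funext fun z => ?_)
    rw [D_const, sub_zero, D_comp (isHolo f.1).D hσ.1]
  obtain ⟨G, hG, hG0, hGk⟩ := exists_primitive hk
  have hint (z : 𝔻) : integralFromZero (fun ξ => D f (σ ξ) - D f (σ 0)) z = G z := by
    rw [← hGk, integralFromZero_D hG hG0]
  have hDD : D (D (c • G)) = fun z => c * D (fun ξ => (σ ξ : ℂ)) z * D (D f) (σ z) := by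
    rw [D_smul c hG, D_smul c hG.D, hGk, hDk]
    funext z
    rw [Pi.smul_apply, smul_eq_mul, mul_assoc]
  have hiff : g.1.toFun = c • G ↔ D (D g) = D (D (c • G)) := by
    refine ⟨fun h => by rw [h], eq_of_D_D_eq (isHolo g.1) (hG.smul c) ?_ ?_⟩
    · rw [g.2.2.1, Pi.smul_apply, hG0, smul_zero]
    · simp [g.2.2.2, D_smul c hG, hGk]
  simp only [hint]
  rw [hDD] at hiff
  exact funext_iff.symm.trans (hiff.trans funext_iff)

/-! ### Recovering the automorphism and the unimodular constant -/

/-- The function with second derivative `z - x` has zero weight at `x` only. -/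
theorem eq_of_weight_eq {x y : 𝔻} (h : ∀ f : littleZygmund01, weight f x = weight f y) : x = y := by
  obtain ⟨e, he⟩ := exists_secondDeriv_eq_one
  obtain ⟨i, hi⟩ := exists_secondDeriv_eq_coe
  have h1 := h (i - (x : ℂ) • e)
  rw [weight_eq, weight_eq, map_sub, map_smul, he, hi] at h1
  simp only [Pi.sub_apply, Pi.smul_apply, smul_eq_mul, mul_one, sub_self, norm_zero, mul_zero] at h1
  have h2 := (mul_eq_zero.1 h1.symm).resolve_left (one_sub_sq_norm_pos y).ne'
  exact Complex.UnitDisc.coe_injective (sub_eq_zero.1 (norm_eq_zero.1 h2)).symm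

/-- Subtracting from `f` the multiple of `e` with the same second derivative at `τ z` gives zero
weight there, hence zero weight of the image at `z`. -/
theorem secondDeriv_eq_mul_of_weight_eq {L : littleZygmund01 →ₗ[ℂ] littleZygmund01} {τ : 𝔻 → 𝔻}
    (h : ∀ f z, weight (L f) z = weight f (τ z)) {e : littleZygmund01}
    (he : secondDeriv e = fun _ => 1) (f : littleZygmund01) (z : 𝔻) :
    secondDeriv (L f) z = secondDeriv (L e) z * secondDeriv f (τ z) := by
  have h1 := h (f - secondDeriv f (τ z) • e) z
  rw [weight_eq, weight_eq, map_sub, map_sub, map_smul, map_sub, map_smul, map_smul, he] at h1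
  simp only [Pi.sub_apply, Pi.smul_apply, smul_eq_mul, mul_one, sub_self, norm_zero, mul_zero] at h1
  have h2 := (mul_eq_zero.1 h1).resolve_left (one_sub_sq_norm_pos z).ne'
  rw [sub_eq_zero.1 (norm_eq_zero.1 h2), mul_comm]

/-- Taking `f'' = z` and `f'' = 1` in the multiplicative formula exhibits `τ` as a quotient with
nonvanishing denominator. -/
theorem isHolo_of_weight_eq {L : littleZygmund01 →ₗ[ℂ] littleZygmund01} {τ : 𝔻 → 𝔻}
    (h : ∀ f z, weight (L f) z = weight f (τ z)) : IsHolo fun z => (τ z : ℂ) := by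
  obtain ⟨e, he⟩ := exists_secondDeriv_eq_one
  obtain ⟨i, hi⟩ := exists_secondDeriv_eq_coe
  have hne (z : 𝔻) : secondDeriv (L e) z ≠ 0 := by
    intro h0
    have h1 := h e z
    rw [weight_eq, weight_eq, h0, he, norm_zero, mul_zero, norm_one, mul_one] at h1
    exact (one_sub_sq_norm_pos (τ z)).ne h1
  have : (fun z => (τ z : ℂ)) = secondDeriv (L i) / secondDeriv (L e) := by
    funext z
    rw [Pi.div_apply, secondDeriv_eq_mul_of_weight_eq h he, hi, mul_div_cancel_left₀ _ (hne z)]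
  rw [this]
  exact (isHolo_secondDeriv _).div (isHolo_secondDeriv _) hne

theorem eq_apply_zero_of_norm_eq_one {c : 𝔻 → ℂ} (hc : IsHolo c) (h : ∀ z, ‖c z‖ = 1) (z : 𝔻) :
    c z = c 0 := by
  have hmax : IsMaxOn (norm ∘ toPlane c) (ball 0 1) ((0 : 𝔻) : ℂ) := by
    intro w hw
    lift w to 𝔻 using mem_ball_zero_iff.1 hw
    simp only [mem_ofPred_eq, Function.comp_apply, toPlane_coe, h, le_refl]
  have := Complex.eqOn_of_isPreconnected_of_isMaxOn_norm (convex_ball (0 : ℂ) 1).isPreconnected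
    isOpen_ball hc (coe_mem_ball 0) hmax (coe_mem_ball z)
  simpa only [toPlane_coe, Function.const_apply] using this

theorem exists_exp_mul_I_eq {c : ℂ} (hc : ‖c‖ = 1) : ∃ α : ℝ, Complex.exp (α * Complex.I) = c :=
  ⟨c.arg, by simpa [hc] using Complex.norm_mul_exp_arg_mul_I c⟩

/-- Surjective linear isometries of `𝒵₀^{(0,1)}` act on second derivatives as weighted composition
operators. -/
theorem exists_secondDeriv_eq_of_isometry (T : littleZygmund01 ≃ₗᵢ[ℂ] littleZygmund01) :
    ∃ (σ : 𝔻 ≃ 𝔻) (α : ℝ), IsDiscAutomorphism σ ∧ ∀ f z,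
      secondDeriv (T f) z =
        Complex.exp (α * Complex.I) * D (fun ξ => (σ ξ : ℂ)) z * secondDeriv f (σ z) := by
  -- The inverse is used because the lemma sends source points to image points, while the symbol of
  -- `T` must be defined at every image point.
  choose τ hτ using exists_weight_eq_weight T.symm.toLinearIsometry
  choose τ' hτ' using exists_weight_eq_weight T.toLinearIsometry
  have hT (f : littleZygmund01) (z : 𝔻) : weight (T f) z = weight f (τ z) := by
    rw [← hτ]
    simp
  have hT' (f : littleZygmund01) (z : 𝔻) : weight (T.symm f) z = weight f (τ' z) := by
    rw [← hτ']
    simp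
  let σ : 𝔻 ≃ 𝔻 :=
    { toFun := τ
      invFun := τ'
      left_inv := fun z => eq_of_weight_eq fun f => by
        rw [← hT', ← hT, T.apply_symm_apply]
      right_inv := fun z => eq_of_weight_eq fun f => by
        rw [← hT, ← hT', T.symm_apply_apply] }
  have hσ : IsDiscAutomorphism σ :=
    ⟨isHolo_of_weight_eq (L := T.toLinearEquiv.toLinearMap) hT,
      isHolo_of_weight_eq (L := T.symm.toLinearEquiv.toLinearMap) hT'⟩
  obtain ⟨e, he⟩ := exists_secondDeriv_eq_one
  have hne (z : 𝔻) : D (fun ξ => (σ ξ : ℂ)) z ≠ 0 := left_ne_zero_of_mul_eq_one (hσ.D_symm_mul z)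
  -- The weight of `T e` at `z` is `1 - |σ z|²`, which equals `(1 - |z|²)|σ'(z)|` by Schwarz-Pick
  -- equality.
  have hnorm (z : 𝔻) : ‖(secondDeriv (T e) / D fun ξ => (σ ξ : ℂ)) z‖ = 1 := by
    have h1 := hT e z
    rw [weight_eq, weight_eq, he, norm_one, mul_one, ← show σ z = τ z from rfl, ← hσ.norm_D] at h1
    rw [Pi.div_apply, norm_div, mul_left_cancel₀ (one_sub_sq_norm_pos z).ne' h1,
      div_self (norm_ne_zero_iff.2 (hne z))]
  have hconst := eq_apply_zero_of_norm_eq_one ((isHolo_secondDeriv (T e)).div hσ.1.D hne) hnorm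
  obtain ⟨α, hα⟩ := exists_exp_mul_I_eq (hnorm 0)
  refine ⟨σ, α, hσ, fun f z => ?_⟩
  rw [hα, ← hconst z, Pi.div_apply, div_mul_cancel₀ _ (hne z)]
  exact secondDeriv_eq_mul_of_weight_eq (L := T.toLinearEquiv.toLinearMap) hT he f z

/-- Weighted composition operators of second derivatives are surjective linear isometries of
`𝒵₀^{(0,1)}`. -/
theorem isometry_of_secondDeriv_eq {T : littleZygmund01 → littleZygmund01} {σ : 𝔻 ≃ 𝔻}
    (hσ : IsDiscAutomorphism σ) {c : ℂ} (hc : ‖c‖ = 1)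
    (h : ∀ f z, secondDeriv (T f) z = c * D (fun ξ => (σ ξ : ℂ)) z * secondDeriv f (σ z)) :
    IsLinearMap ℂ T ∧ Isometry T ∧ Function.Surjective T := by
  have hlin : IsLinearMap ℂ T := by
    refine ⟨fun f g => ?_, fun a f => ?_⟩ <;> refine secondDeriv_injective (funext fun z => ?_)
    · simp only [map_add, Pi.add_apply, h]
      ring
    · simp only [map_smul, Pi.smul_apply, h, smul_eq_mul]
      ring
  refine ⟨hlin, AddMonoidHomClass.isometry_of_norm (hlin.mk' T) fun f =>
    norm_eq_norm_of_weight_eq σ (hσ.weight_eq_of_secondDeriv_eq hc (h f)), fun k => ?_⟩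
  obtain ⟨g, hg⟩ := hσ.symm.exists_secondDeriv_eq k
  have hc0 : c ≠ 0 := norm_ne_zero_iff.1 (by rw [hc]; exact one_ne_zero)
  -- The preimage comes from the weighted composition with the inverse automorphism, whose
  -- derivative cancels that of `σ`.
  refine ⟨c⁻¹ • g, secondDeriv_injective (funext fun z => ?_)⟩
  rw [h, map_smul, Pi.smul_apply, hg, Equiv.symm_apply_apply, smul_eq_mul, mul_mul_mul_comm,
    mul_inv_cancel₀ hc0, one_mul, ← mul_assoc, hσ.D_symm_mul, one_mul]

end Zygmund

theorem theorem3p1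
    (T : ↥Zygmund.littleZygmund01 → ↥Zygmund.littleZygmund01) :
    ((IsLinearMap ℂ T ∧ Isometry T ∧ Function.Surjective T) ↔
      ∃ (σ : 𝔻 ≃ 𝔻) (α : ℝ), Zygmund.IsDiscAutomorphism σ ∧
        ∀ (f : ↥Zygmund.littleZygmund01) (z : 𝔻),
          T f z = Complex.exp (α * Complex.I) *
            Zygmund.integralFromZero (fun ξ => Zygmund.D f (σ ξ) - Zygmund.D f (σ 0)) z) ∧
    (∀ (σ : 𝔻 ≃ 𝔻) (α : ℝ), Zygmund.IsDiscAutomorphism σ →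
      ∀ f : ↥Zygmund.littleZygmund01,
        (∀ z : 𝔻, T f z = Complex.exp (α * Complex.I) *
            Zygmund.integralFromZero (fun ξ => Zygmund.D f (σ ξ) - Zygmund.D f (σ 0)) z) ↔
        (∀ z : 𝔻, Zygmund.D (Zygmund.D (T f)) z = Complex.exp (α * Complex.I) *
            Zygmund.D (fun ξ => (σ ξ : ℂ)) z * Zygmund.D (Zygmund.D f) (σ z))) := by
  refine ⟨⟨?_, ?_⟩, fun σ α hσ f => Zygmund.eq_exp_mul_integralFromZero_iff hσ _ f (T f)⟩
  · rintro ⟨hlin, hiso, hsurj⟩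
    obtain ⟨σ, α, hσ, h⟩ := Zygmund.exists_secondDeriv_eq_of_isometry
      (LinearIsometryEquiv.ofSurjective ⟨hlin.mk' T, fun f => by
        have := hiso.dist_eq f 0
        rwa [hlin.map_zero, dist_zero_right, dist_zero_right] at this⟩ hsurj)
    exact ⟨σ, α, hσ, fun f => (Zygmund.eq_exp_mul_integralFromZero_iff hσ _ f (T f)).2 (h f)⟩
  · rintro ⟨σ, α, hσ, h⟩
    exact Zygmund.isometry_of_secondDeriv_eq hσ (Complex.norm_exp_ofReal_mul_I α) fun f =>
      (Zygmund.eq_exp_mul_integralFromZero_iff hσ _ f (T f)).1 (h f)
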